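/- Let $d$ be a prime number, let $n$ be a natural number, and let $\mathcal H=\mathbb C^d$ with computational basis $\{|k\rangle\}_{k\in\mathbb Z_d}$, so that $\mathcal H^{\otimes n}$ has the basis $|\vec i\rangle=|i_1\rangle\otimes\cdots\otimes|i_n\rangle$, $\vec i\in\mathbb Z_d^n$. Write $\mathcal D(\mathcal H^{\otimes n})$ for the set of $n$-qudit states (positive semidefinite operators of trace one). Let $G=\begin{pmatrix}g_{00}&g_{01}\\ g_{10}&g_{11}\end{pmatrix}$ be an invertible matrix over $\mathbb Z_d$ that is positive, i.e. $g_{ab}\neq 0$ in $\mathbb Z_d$ for all $a,b$. Let $U$ be the unitary on $\mathcal H^{\otimes n}\otimes\mathcal H^{\otimes n}$ given by $$U=\sum_{\vec i,\vec j\in\mathbb Z_d^n}|\vec i'\rangle\langle\vec i|\otimes|\vec j'\rangle\langle\vec j|,\qquad \begin{pmatrix}i'_k\\ j'_k\end{pmatrix}=(G^{-1})^T\begin{pmatrix}i_k\\ j_k\end{pmatrix}\quad(1\le k\le n),$$ and define the convolution of two states $\rho,\tau\in\mathcal D(\mathcal H^{\otimes n})$ by $\rho\boxtimes\tau=\mathrm{Tr}_B[U(\rho\otimes\tau)U^\dagger]$,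 where $\mathrm{Tr}_B$ is the partial trace over the second factor $\mathcal H^{\otimes n}$. **Proposition (Monotonicity under convolution).** For all $\rho,\sigma,\tau\in\mathcal D(\mathcal H^{\otimes n})$, $$D(\rho\boxtimes\tau,\ \sigma\boxtimes\tau)\le D(\rho,\sigma),$$ where $D$ is any one of the following: 1. the $L_1$ distance $D(\rho,\sigma)=\|\rho-\sigma\|_1=\mathrm{Tr}\sqrt{(\rho-\sigma)^\dagger(\rho-\sigma)}$; 2. the quantum relative entropy $D(\rho,\sigma)=D(\rho\|\sigma)=\mathrm{Tr}[\rho(\log\rho-\log\sigma)]$ if $\mathrm{supp}\,\rho\subseteq\mathrm{supp}\,\sigma$, and $D(\rho\|\sigma)=+\infty$ otherwise; 3. the quantum Wasserstein distance of order one of De Palma, Marvian, Trevisan and Lloyd, $$D(\rho,\sigma)=\min\Big\{\sum_{i=1}^n c_i:\ c_i\ge 0,\ \rho-\sigma=\sum_{i=1}^n c_i\,(\mu^{(i)}-\nu^{(i)}),\ \mu^{(i)},\nu^{(i)}\in\mathcal D(\mathcal H^{\otimes n}),\ \mathrm{Tr}_i\,\mu^{(i)}=\mathrm{Tr}_i\,\nu^{(i)}\Big\},$$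 where $\mathrm{Tr}_i$ is the partial trace over the $i$-th qudit. -/

import Mathlib

open scoped Matrix Kronecker ENNReal NNReal ComplexOrder

namespace QuantumConvolution

noncomputable section

/-- Labels of the computational basis `|i₁,…,iₙ⟩` of `(ℂ^d)^{⊗ n}`. Operators on `(ℂ^d)^{⊗ n}` are
complex matrices indexed by these labels, and operators on the tensor product of two such systems
are matrices indexed by pairs of labels. -/
abbrev Label (d n : ℕ) : Type := Fin n → ZMod d

/-- Quantum states (density matrices): positive semidefinite matrices of trace one. -/
structure QState (ι : Type*) [Fintype ι] where
  /-- The underlying matrix. -/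
  mat : Matrix ι ι ℂ
  posSemidef : mat.PosSemidef
  trace_eq_one : mat.trace = 1

/-- Partial trace over the second tensor factor. -/
def partialTraceRight {ι κ : Type*} [Fintype κ] (M : Matrix (ι × κ) (ι × κ) ℂ) : Matrix ι ι ℂ :=
  Matrix.of fun a b => ∑ k, M (a, k) (b, k)

/-- Partial trace over the `i`-th qudit of an `n`-qudit system; the remaining qudits are indexed by
`{j // j ≠ i}`. -/
def traceQudit {d n : ℕ} [NeZero d] (i : Fin n) (M : Matrix (Label d n) (Label d n) ℂ) :
    Matrix ({j : Fin n // j ≠ i} → ZMod d) ({j : Fin n // j ≠ i} → ZMod d) ℂ :=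
  Matrix.of fun a b => ∑ x : ZMod d,
    M ((Equiv.funSplitAt i (ZMod d)).symm (x, a)) ((Equiv.funSplitAt i (ZMod d)).symm (x, b))

/-- `G` is positive if none of its entries vanishes. -/
def IsPositive {d : ℕ} (G : GL (Fin 2) (ZMod d)) : Prop :=
  ∀ a b : Fin 2, (G : Matrix (Fin 2) (Fin 2) (ZMod d)) a b ≠ 0

/-- The map `(i, j) ↦ (i', j')` with `(i'ₖ, j'ₖ)ᵀ = (G⁻¹)ᵀ (iₖ, jₖ)ᵀ` for every `k`. -/
def keyMap {d n : ℕ} (G : GL (Fin 2) (ZMod d)) (p : Label d n × Label d n) :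
    Label d n × Label d n :=
  (fun k => ((((G⁻¹ : GL (Fin 2) (ZMod d)) : Matrix (Fin 2) (Fin 2) (ZMod d))ᵀ) *ᵥ
      ![p.1 k, p.2 k]) 0,
   fun k => ((((G⁻¹ : GL (Fin 2) (ZMod d)) : Matrix (Fin 2) (Fin 2) (ZMod d))ᵀ) *ᵥ
      ![p.1 k, p.2 k]) 1)

/-- The key unitary `U = ∑_{i,j} |i'⟩⟨i| ⊗ |j'⟩⟨j|`. -/
def keyUnitary {d : ℕ} [NeZero d] (n : ℕ) (G : GL (Fin 2) (ZMod d)) :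
    Matrix (Label d n × Label d n) (Label d n × Label d n) ℂ :=
  ∑ i : Label d n, ∑ j : Label d n,
    Matrix.single (keyMap G (i, j)).1 i (1 : ℂ) ⊗ₖ Matrix.single (keyMap G (i, j)).2 j (1 : ℂ)

theorem keyMap_injective {d n : ℕ} (G : GL (Fin 2) (ZMod d)) :
    Function.Injective (keyMap (n := n) G) := by
  intro p q h
  have hinj : Function.Injective
      ((((G⁻¹ : GL (Fin 2) (ZMod d)) : Matrix (Fin 2) (Fin 2) (ZMod d))ᵀ).mulVec) := by
    apply Matrix.mulVec_injective_of_isUnit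
    rw [Matrix.isUnit_transpose]
    exact (G⁻¹).isUnit
  have hk : ∀ k, (![p.1 k, p.2 k] : Fin 2 → ZMod d) = ![q.1 k, q.2 k] := by
    intro k
    apply hinj
    have h0 := congrFun (congrArg Prod.fst h) k
    have h1 := congrFun (congrArg Prod.snd h) k
    funext a
    fin_cases a
    · exact h0
    · exact h1
  refine Prod.ext (funext fun k => ?_) (funext fun k => ?_)
  · simpa using congrFun (hk k) 0
  · simpa using congrFun (hk k) 1

theorem keyUnitary_apply {d n : ℕ} [NeZero d] (G : GL (Fin 2) (ZMod d))
    (p q : Label d n × Label d n) :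
    keyUnitary n G p q = if keyMap G q = p then 1 else 0 := by
  obtain ⟨p1, p2⟩ := p
  obtain ⟨q1, q2⟩ := q
  simp only [keyUnitary, Matrix.sum_apply, Matrix.kroneckerMap_apply, Matrix.single_apply]
  rw [Finset.sum_eq_single q1, Finset.sum_eq_single q2]
  · by_cases h1 : (keyMap G (q1, q2)).1 = p1 <;> by_cases h2 : (keyMap G (q1, q2)).2 = p2 <;>
      simp [h1, h2, Prod.ext_iff]
  · intro b _ hb
    simp [hb]
  · simp
  · intro b _ hb
    simp [hb]
  · simp

theorem keyUnitary_conjTranspose_mul {d n : ℕ} [NeZero d] (G : GL (Fin 2) (ZMod d)) :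
    (keyUnitary n G)ᴴ * keyUnitary n G = 1 := by
  ext p q
  simp only [Matrix.mul_apply, Matrix.conjTranspose_apply, keyUnitary_apply, Matrix.one_apply]
  rw [Finset.sum_eq_single (keyMap G p)]
  · by_cases h : p = q
    · simp [h]
    · have h' : ¬ keyMap G q = keyMap G p := fun e => h (keyMap_injective G e).symm
      simp [h, h']
  · intro b _ hb
    simp [Ne.symm hb]
  · simp

theorem partialTraceRight_posSemidef {ι κ : Type*} [Fintype ι] [Fintype κ]
    {M : Matrix (ι × κ) (ι × κ) ℂ} (hM : M.PosSemidef) : (partialTraceRight M).PosSemidef := by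
  have h : partialTraceRight M = ∑ k, M.submatrix (fun a => (a, k)) (fun a => (a, k)) := by
    ext a b
    simp [partialTraceRight, Matrix.sum_apply]
  rw [h]
  exact Matrix.posSemidef_sum _ fun k _ => hM.submatrix _

theorem partialTraceRight_trace {ι κ : Type*} [Fintype ι] [Fintype κ]
    (M : Matrix (ι × κ) (ι × κ) ℂ) : (partialTraceRight M).trace = M.trace := by
  simp [partialTraceRight, Matrix.trace, Fintype.sum_prod_type]

/-- The convolution `ρ ⊠ σ = Tr_B [U (ρ ⊗ σ) U†]` of two `n`-qudit states. -/
def conv {d n : ℕ} [NeZero d] (G : GL (Fin 2) (ZMod d)) (ρ σ : QState (Label d n)) :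
    QState (Label d n) where
  mat := partialTraceRight (keyUnitary n G * (ρ.mat ⊗ₖ σ.mat) * (keyUnitary n G)ᴴ)
  posSemidef := partialTraceRight_posSemidef
    ((ρ.posSemidef.kronecker σ.posSemidef).mul_mul_conjTranspose_same _)
  trace_eq_one := by
    rw [partialTraceRight_trace, Matrix.trace_mul_comm, ← Matrix.mul_assoc,
      keyUnitary_conjTranspose_mul, Matrix.one_mul, Matrix.trace_kronecker,
      ρ.trace_eq_one, σ.trace_eq_one, mul_one]

/-- The `L₁` (trace) distance `‖ρ - σ‖₁ = Tr √((ρ - σ)† (ρ - σ))`. The square root is taken by the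
functional calculus of Hermitian matrices. -/
def l1Dist {ι : Type*} [Fintype ι] [DecidableEq ι] (ρ σ : QState ι) : ℝ :=
  (cfc Real.sqrt ((ρ.mat - σ.mat)ᴴ * (ρ.mat - σ.mat))).trace.re

open Classical in
/-- The quantum relative entropy: `D(ρ‖σ) = Tr [ρ (log ρ - log σ)]` if the support of `ρ` is
contained in that of `σ` (equivalently `ker σ ⊆ ker ρ`), and `+∞` otherwise. Logarithms are taken by
the functional calculus with `Real.log 0 = 0`, the usual convention `0 log 0 = 0`. -/
def relEntropy {ι : Type*} [Fintype ι] [DecidableEq ι] (ρ σ : QState ι) : EReal :=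
  if ∀ v : ι → ℂ, σ.mat *ᵥ v = 0 → ρ.mat *ᵥ v = 0 then
    (((ρ.mat * (cfc Real.log ρ.mat - cfc Real.log σ.mat)).trace.re : ℝ) : EReal)
  else ⊤

/-- The quantum Wasserstein distance of order one: the minimum of `∑ᵢ cᵢ` over all decompositions
`ρ - σ = ∑ᵢ cᵢ (μᵢ - νᵢ)` with `cᵢ ≥ 0` and, for every `i`, states `μᵢ`, `νᵢ` that coincide after the
`i`-th qudit is discarded. -/
def wassersteinDist {d n : ℕ} [NeZero d] (ρ σ : QState (Label d n)) : ℝ≥0∞ :=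
  ⨅ (c : Fin n → ℝ≥0) (μ : Fin n → QState (Label d n)) (ν : Fin n → QState (Label d n))
    (_ : ∀ i, traceQudit i (μ i).mat = traceQudit i (ν i).mat)
    (_ : ρ.mat - σ.mat = ∑ i, ((c i : ℝ) : ℂ) • ((μ i).mat - (ν i).mat)),
    ∑ i, (c i : ℝ≥0∞)

end

end QuantumConvolution

/-! For fixed `τ`, convolution is a channel `X ↦ ∑ₐ Kₐ X Kₐ†` with `∑ₐ Kₐ† Kₐ = 1`
(`exists_kraus_conv`), and the first two bounds hold for every channel. For the `L₁` distance, a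
channel carries the Jordan decomposition of `ρ - σ` to a difference of positive matrices with the
same traces, and the sum of these traces bounds the trace norm.

For the relative entropy, let `p`, `q` be the eigenvalues of `ρ`, `σ` and `m` the squared overlaps
of their eigenvectors. When the supports are nested, `D(ρ‖σ) = ∑ m p (log p - log q)` is the growth
of `F(t) = ∑ m p log (q + t p)` from `t = 0` to `t = ∞`, once `log t` is subtracted at infinity. The
derivative `∑ m p² / (q + t p)` is the maximum over `Y` of `modularForm`, and by the Kadison–Schwarz
inequality that maximum cannot increase under a channel (`modularForm_krausMap_le`).
`sum_mul_log_sub_le` passes from derivatives to entropies.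

The Wasserstein bound also needs locality: `U` acts separately on each pair of corresponding qudits,
so the marginal of `ρ ⊠ τ` without qudit `i` depends on `ρ` only through the same marginal
(`traceQudit_conv_apply`). Decompositions are therefore pushed forward with unchanged coefficients.
-/

namespace QuantumConvolution

noncomputable section

/-! ### Spectral calculus and the trace norm -/

section Spectral

theorem diagonal_ofReal_posSemidef {ι : Type*} [DecidableEq ι] {p : ι → ℝ} (hp : ∀ i, 0 ≤ p i) :
    (Matrix.diagonal (fun i => (p i : ℂ))).PosSemidef :=
  Matrix.PosSemidef.diagonal fun i => by simpa using hp i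

theorem re_trace_nonneg {ι : Type*} [Fintype ι] {A : Matrix ι ι ℂ} (hA : A.PosSemidef) : 0 ≤ A.trace.re :=
  (Complex.le_def.1 hA.trace_nonneg).1

theorem re_diag_nonneg {ι : Type*} {A : Matrix ι ι ℂ} (hA : A.PosSemidef) (i : ι) : 0 ≤ (A i i).re :=
  (Complex.le_def.1 (hA.diag_nonneg (i := i))).1

variable {ι : Type*} [Fintype ι] [DecidableEq ι] {A : Matrix ι ι ℂ}

/-- The spectral theorem, together with the functional calculus in the eigenbasis. -/
theorem exists_diagonalization (hA : A.IsHermitian) :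
    ∃ (V : Matrix ι ι ℂ) (p : ι → ℝ), Vᴴ * V = 1 ∧ V * Vᴴ = 1 ∧
      A = V * Matrix.diagonal (fun i => (p i : ℂ)) * Vᴴ ∧
      (A.PosSemidef → ∀ i, 0 ≤ p i) ∧
      ∀ f : ℝ → ℝ, cfc f A = V * Matrix.diagonal (fun i => (f (p i) : ℂ)) * Vᴴ := by
  refine ⟨hA.eigenvectorUnitary, hA.eigenvalues, ?_, ?_, ?_, ?_, ?_⟩
  · exact Unitary.coe_star_mul_self hA.eigenvectorUnitary
  · exact Unitary.coe_mul_star_self hA.eigenvectorUnitary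
  · exact hA.spectral_theorem
  · exact fun h => h.eigenvalues_nonneg
  · intro f
    rw [hA.cfc_eq]
    rfl

theorem exists_eq_mul_conjTranspose (hA : A.PosSemidef) : ∃ B : Matrix ι ι ℂ, A = B * Bᴴ := by
  obtain ⟨V, p, -, -, hV, hp, -⟩ := exists_diagonalization hA.isHermitian
  refine ⟨V * Matrix.diagonal (fun i => (Real.sqrt (p i) : ℂ)), ?_⟩
  have h : (fun i => (Real.sqrt (p i) : ℂ) * (Real.sqrt (p i) : ℂ)) = fun i => (p i : ℂ) := by
    funext i
    rw [← Complex.ofReal_mul, Real.mul_self_sqrt (hp hA i)]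
  rw [Matrix.conjTranspose_mul, Matrix.diagonal_conjTranspose, Matrix.mul_assoc,
    ← Matrix.mul_assoc (Matrix.diagonal _) (Matrix.diagonal _)]
  have h' : star (fun i => (Real.sqrt (p i) : ℂ)) = fun i => (Real.sqrt (p i) : ℂ) := by
    funext i
    simp
  rw [h', Matrix.diagonal_mul_diagonal, h, ← Matrix.mul_assoc]
  exact hV

theorem trace_conj_isometry {κ : Type*} [Fintype κ] [DecidableEq κ] {V : Matrix κ ι ℂ}
    (hV : Vᴴ * V = 1) (M : Matrix ι ι ℂ) : (V * M * Vᴴ).trace = M.trace := by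
  rw [Matrix.trace_mul_comm, ← Matrix.mul_assoc, hV, Matrix.one_mul]

theorem cfc_sqrt_conjTranspose_mul_self (hA : A.IsHermitian) :
    cfc Real.sqrt (Aᴴ * A) = cfc (fun x : ℝ => |x|) A := by
  have hs : IsSelfAdjoint A := hA
  have h : Aᴴ * A = cfc (fun x : ℝ => x ^ 2) A := by
    rw [cfc_pow_id (R := ℝ) A 2 hs, hA.eq, sq]
  rw [h, ← cfc_comp' Real.sqrt (fun x : ℝ => x ^ 2) A]
  simp only [Real.sqrt_sq_eq_abs]

/-- The trace norm of a difference of positive semidefinite matrices is at most the sum of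
their traces. -/
theorem re_trace_abs_sub_le {P Q : Matrix ι ι ℂ} (hP : P.PosSemidef) (hQ : Q.PosSemidef) :
    (cfc (fun x : ℝ => |x|) (P - Q)).trace.re ≤ P.trace.re + Q.trace.re := by
  obtain ⟨V, p, hV, hV', hA, -, hf⟩ := exists_diagonalization (hP.isHermitian.sub hQ.isHermitian)
  have hd : Vᴴ * P * V - Vᴴ * Q * V = Matrix.diagonal (fun i => (p i : ℂ)) := by
    rw [← Matrix.sub_mul, ← Matrix.mul_sub, hA]
    simp only [← Matrix.mul_assoc, hV, Matrix.one_mul]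
    rw [Matrix.mul_assoc, hV, Matrix.mul_one]
  have hP' := hP.conjTranspose_mul_mul_same V
  have hQ' := hQ.conjTranspose_mul_mul_same V
  have key (M : Matrix ι ι ℂ) : M.trace.re = ∑ i, ((Vᴴ * M * V) i i).re := by
    have h : (Vᴴ * M * V).trace = M.trace := by
      simpa using trace_conj_isometry (V := Vᴴ) (by simpa using hV') M
    rw [← h, Matrix.trace, Complex.re_sum]
    rfl
  rw [hf, trace_conj_isometry hV, key P, key Q, Matrix.trace_diagonal, Complex.re_sum,
    ← Finset.sum_add_distrib]
  -- In the eigenbasis of `P - Q`, each eigenvalue is a difference of nonnegative diagonal entries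
  -- of `P` and `Q`.
  refine Finset.sum_le_sum fun i _ => ?_
  have h1 : ((Vᴴ * P * V) i i).re - ((Vᴴ * Q * V) i i).re = p i := by
    have := congrArg Complex.re (congrFun (congrFun hd i) i)
    simpa using this
  have h2 := re_diag_nonneg hP' i
  have h3 := re_diag_nonneg hQ' i
  rw [Complex.ofReal_re, abs_le]
  constructor <;> linarith

/-- The Jordan decomposition of a Hermitian matrix attains its trace norm. -/
theorem exists_jordan_decomposition (hA : A.IsHermitian) :
    ∃ P Q : Matrix ι ι ℂ, P.PosSemidef ∧ Q.PosSemidef ∧ A = P - Q ∧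
      P.trace.re + Q.trace.re = (cfc (fun x : ℝ => |x|) A).trace.re := by
  obtain ⟨V, p, hV, -, hp, -, hf⟩ := exists_diagonalization hA
  refine ⟨V * Matrix.diagonal (fun i => ((max (p i) 0 : ℝ) : ℂ)) * Vᴴ,
    V * Matrix.diagonal (fun i => ((max (-p i) 0 : ℝ) : ℂ)) * Vᴴ,
    (diagonal_ofReal_posSemidef fun i => le_max_right _ _).mul_mul_conjTranspose_same V,
    (diagonal_ofReal_posSemidef fun i => le_max_right _ _).mul_mul_conjTranspose_same V, ?_, ?_⟩
  · rw [← Matrix.sub_mul, ← Matrix.mul_sub, Matrix.diagonal_sub, hp]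
    congr 3
    funext i
    rw [← Complex.ofReal_sub, max_comm, max_comm (-p i)]
    congr 1
    rcases le_total (p i) 0 with h | h
    · simp [h]
    · simp [h]
  · rw [hf]
    simp only [trace_conj_isometry hV, Matrix.trace_diagonal, Complex.re_sum, Complex.ofReal_re,
      ← Finset.sum_add_distrib]
    refine Finset.sum_congr rfl fun i _ => ?_
    rcases le_total (p i) 0 with h | h
    · simp [h, abs_of_nonpos h]
    · simp [h, abs_of_nonneg h]

end Spectral

/-! ### Channels in Kraus form -/

section Kraus

/-- The map `X ↦ ∑ₐ Kₐ† X Kₐ`, adjoint to `krausMap K` for the trace pairing. -/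
def krausAdjoint {α ι κ : Type*} [Fintype α] [Fintype κ] (K : α → Matrix κ ι ℂ) (Y : Matrix κ κ ℂ) : Matrix ι ι ℂ :=
  ∑ a, (K a)ᴴ * Y * K a

theorem conjTranspose_krausAdjoint {α ι κ : Type*} [Fintype α] [Fintype κ]
    (K : α → Matrix κ ι ℂ) (Y : Matrix κ κ ℂ) :
    (krausAdjoint K Y)ᴴ = krausAdjoint K Yᴴ := by
  simp [krausAdjoint, Matrix.conjTranspose_sum, Matrix.mul_assoc]

variable {α ι κ : Type*} [Fintype α] [Fintype ι]

/-- The completely positive map `X ↦ ∑ₐ Kₐ X Kₐ†`. -/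
def krausMap (K : α → Matrix κ ι ℂ) : Matrix ι ι ℂ →ₗ[ℂ] Matrix κ κ ℂ where
  toFun X := ∑ a, K a * X * (K a)ᴴ
  map_add' X Y := by simp only [Matrix.mul_add, Matrix.add_mul, Finset.sum_add_distrib]
  map_smul' c X := by
    simp only [Matrix.mul_smul, Matrix.smul_mul, Finset.smul_sum, RingHom.id_apply]

theorem krausMap_apply (K : α → Matrix κ ι ℂ) (X : Matrix ι ι ℂ) :
    krausMap K X = ∑ a, K a * X * (K a)ᴴ := rfl

theorem krausMap_posSemidef [Finite κ] (K : α → Matrix κ ι ℂ) {X : Matrix ι ι ℂ} (hX : X.PosSemidef) :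
    (krausMap K X).PosSemidef :=
  Matrix.posSemidef_sum _ fun a _ => hX.mul_mul_conjTranspose_same (K a)

variable [Fintype κ]

theorem trace_mul_krausMap (K : α → Matrix κ ι ℂ) (Y : Matrix κ κ ℂ) (X : Matrix ι ι ℂ) :
    (Y * krausMap K X).trace = (krausAdjoint K Y * X).trace := by
  simp only [krausMap_apply, krausAdjoint, Matrix.mul_sum, Matrix.sum_mul, Matrix.trace_sum]
  refine Finset.sum_congr rfl fun a _ => ?_
  rw [← Matrix.mul_assoc, Matrix.trace_mul_comm]
  simp only [Matrix.mul_assoc]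

/-- If `v` is in the kernel of the image of `S`, the nonnegative terms `⟨Kₐ† v, S Kₐ† v⟩` sum to
zero, so every `Kₐ† v` lies in `ker S`. This transports the support condition. -/
theorem ker_krausMap_le (K : α → Matrix κ ι ℂ) {R S : Matrix ι ι ℂ} (hS : S.PosSemidef)
    (h : ∀ v, S *ᵥ v = 0 → R *ᵥ v = 0) (v : κ → ℂ) (hv : krausMap K S *ᵥ v = 0) :
    krausMap K R *ᵥ v = 0 := by
  have e (X : Matrix ι ι ℂ) : krausMap K X *ᵥ v = ∑ a, K a *ᵥ (X *ᵥ ((K a)ᴴ *ᵥ v)) := by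
    simp [krausMap_apply, Matrix.sum_mulVec, Matrix.mulVec_mulVec, Matrix.mul_assoc]
  have h0 : ∑ a, star ((K a)ᴴ *ᵥ v) ⬝ᵥ (S *ᵥ ((K a)ᴴ *ᵥ v)) = 0 := by
    have h1 : star v ⬝ᵥ (krausMap K S *ᵥ v) = 0 := by simp [hv]
    rw [e, dotProduct_sum] at h1
    rw [← h1]
    refine Finset.sum_congr rfl fun a _ => ?_
    rw [Matrix.star_mulVec, Matrix.conjTranspose_conjTranspose, ← Matrix.dotProduct_mulVec]
  rw [e]
  refine Finset.sum_eq_zero fun a ha => ?_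
  have h2 := (Finset.sum_eq_zero_iff_of_nonneg
    fun a _ => hS.dotProduct_mulVec_nonneg ((K a)ᴴ *ᵥ v)).1 h0 a ha
  rw [h _ ((hS.dotProduct_mulVec_zero_iff _).1 h2), Matrix.mulVec_zero]

variable [DecidableEq ι] {K : α → Matrix κ ι ℂ}

theorem trace_krausMap [DecidableEq κ] (hK : ∑ a, (K a)ᴴ * K a = 1) (X : Matrix ι ι ℂ) :
    (krausMap K X).trace = X.trace := by
  have h := trace_mul_krausMap K 1 X
  simpa [krausAdjoint, hK] using h

/-- The Kadison–Schwarz inequality for the adjoint of a channel, paired with a positive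
semidefinite matrix. -/
theorem re_trace_krausAdjoint_le (hK : ∑ a, (K a)ᴴ * K a = 1) {S : Matrix ι ι ℂ}
    (hS : S.PosSemidef) (Y : Matrix κ κ ℂ) :
    ((krausAdjoint K Y)ᴴ * S * krausAdjoint K Y).trace.re ≤
      (Yᴴ * krausMap K S * Y).trace.re := by
  set Z := krausAdjoint K Y with hZ
  -- Summed over `a`, each cross term contributes `-Tr Z† S Z`, while the last square contributes
  -- `+Tr Z† S Z` because `∑ₐ Kₐ† Kₐ = 1`.
  have h1 : 0 ≤ ∑ a, (((K a)ᴴ * Y - Z * (K a)ᴴ)ᴴ * S * ((K a)ᴴ * Y - Z * (K a)ᴴ)).trace.re :=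
    Finset.sum_nonneg fun a _ => re_trace_nonneg (hS.conjTranspose_mul_mul_same _)
  have h2 : ∑ a, (((K a)ᴴ * Y - Z * (K a)ᴴ)ᴴ * S * ((K a)ᴴ * Y - Z * (K a)ᴴ)).trace =
      (Yᴴ * krausMap K S * Y).trace - (Zᴴ * S * Z).trace := by
    have e (a : α) : (((K a)ᴴ * Y - Z * (K a)ᴴ)ᴴ * S * ((K a)ᴴ * Y - Z * (K a)ᴴ)).trace =
        (Yᴴ * (K a * S * (K a)ᴴ) * Y).trace - ((K a)ᴴ * Yᴴ * K a * (S * Z)).trace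
          - (Zᴴ * S * ((K a)ᴴ * Y * K a)).trace + (Zᴴ * S * Z * ((K a)ᴴ * K a)).trace := by
      have t1 : ((K a)ᴴ * Yᴴ * K a * (S * Z)).trace = (Yᴴ * K a * (S * Z) * (K a)ᴴ).trace := by
        rw [Matrix.trace_mul_comm _ (K a)ᴴ]; simp only [Matrix.mul_assoc]
      have t2 : (Zᴴ * S * ((K a)ᴴ * Y * K a)).trace = (K a * (Zᴴ * S * ((K a)ᴴ * Y))).trace := by
        rw [Matrix.trace_mul_comm (K a)]; simp only [Matrix.mul_assoc]
      have t3 : (Zᴴ * S * Z * ((K a)ᴴ * K a)).trace = (K a * (Zᴴ * S * Z * (K a)ᴴ)).trace := by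
        rw [Matrix.trace_mul_comm (K a)]; simp only [Matrix.mul_assoc]
      rw [t1, t2, t3, ← Matrix.trace_sub, ← Matrix.trace_sub, ← Matrix.trace_add]
      congr 1
      simp only [Matrix.conjTranspose_sub, Matrix.conjTranspose_mul,
        Matrix.conjTranspose_conjTranspose, Matrix.sub_mul, Matrix.mul_sub, Matrix.mul_assoc]
      abel
    have s1 : ∑ a, (K a)ᴴ * Yᴴ * K a = Zᴴ := by rw [hZ, conjTranspose_krausAdjoint, krausAdjoint]
    have s2 : ∑ a, (K a)ᴴ * Y * K a = Z := by rw [hZ, krausAdjoint]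
    simp only [e, Finset.sum_add_distrib, Finset.sum_sub_distrib, ← Matrix.trace_sum,
      ← Matrix.mul_sum, ← Matrix.sum_mul, s1, s2, hK, Matrix.mul_one, ← krausMap_apply]
    rw [← Matrix.mul_assoc Zᴴ]
    ring
  have h3 := congrArg Complex.re h2
  rw [Complex.re_sum, Complex.sub_re] at h3
  linarith

/-- The `L₁` distance does not increase under channels. -/
theorem l1Dist_le_of_krausMap [DecidableEq κ] (hK : ∑ a, (K a)ᴴ * K a = 1)
    {ρ σ : QState ι} {ρ' σ' : QState κ}
    (hρ : ρ'.mat = krausMap K ρ.mat) (hσ : σ'.mat = krausMap K σ.mat) :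
    l1Dist ρ' σ' ≤ l1Dist ρ σ := by
  have hH := ρ.posSemidef.isHermitian.sub σ.posSemidef.isHermitian
  have hH' := ρ'.posSemidef.isHermitian.sub σ'.posSemidef.isHermitian
  rw [l1Dist, l1Dist, cfc_sqrt_conjTranspose_mul_self hH, cfc_sqrt_conjTranspose_mul_self hH']
  obtain ⟨P, Q, hP, hQ, hA, ht⟩ := exists_jordan_decomposition hH
  -- The images of `P` and `Q` need not be orthogonal; positivity and preserved traces suffice.
  rw [← ht, hρ, hσ, ← map_sub, hA, map_sub, ← trace_krausMap hK P, ← trace_krausMap hK Q]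
  exact re_trace_abs_sub_le (krausMap_posSemidef K hP) (krausMap_posSemidef K hQ)

end Kraus

/-! ### Logarithmic sums as integrals over `t` -/

section LogSums

open Filter Topology

variable {X X' : Type*} [Fintype X] [Fintype X']

/-- Terms with `m = 0` or `p = 0` are constantly zero; in all others `q > 0`, so the logarithm is
differentiable even at `t = 0`. -/
theorem hasDerivAt_sum_mul_log {m p q : X → ℝ} (hp : ∀ x, 0 ≤ p x) (hq : ∀ x, 0 ≤ q x)
    (hpq : ∀ x, m x ≠ 0 → p x ≠ 0 → q x ≠ 0) {t : ℝ} (ht : 0 ≤ t) :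
    HasDerivAt (fun t => ∑ x, m x * p x * Real.log (q x + t * p x))
      (∑ x, m x * (p x ^ 2 / (q x + t * p x))) t := by
  refine HasDerivAt.fun_sum fun x _ => ?_
  by_cases hm : m x = 0
  · simpa [hm] using hasDerivAt_const t (0 : ℝ)
  by_cases hx : p x = 0
  · simpa [hx] using hasDerivAt_const t (0 : ℝ)
  have hne : q x + t * p x ≠ 0 := by
    have h1 : 0 < q x := lt_of_le_of_ne (hq x) (Ne.symm (hpq x hm hx))
    have h2 : 0 ≤ t * p x := mul_nonneg ht (hp x)
    positivity
  have h := ((((hasDerivAt_id t).mul_const (p x)).const_add (q x)).log hne).const_mul (m x * p x)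
  refine h.congr_deriv ?_
  simp only [id]
  ring

/-- Write `q + t p = t (q / t + p)` and split off `log t`; terms with `p = 0` vanish. -/
theorem tendsto_sum_mul_log (m p q : X → ℝ) (hp : ∀ x, 0 ≤ p x) (hq : ∀ x, 0 ≤ q x) :
    Tendsto (fun t => ∑ x, m x * p x * Real.log (q x + t * p x)
        - (∑ x, m x * p x) * Real.log t) atTop (𝓝 (∑ x, m x * p x * Real.log (p x))) := by
  have h : Tendsto (fun t : ℝ => ∑ x, m x * p x * Real.log (q x * t⁻¹ + p x)) atTop
      (𝓝 (∑ x, m x * p x * Real.log (p x))) := by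
    refine tendsto_finsetSum _ fun x _ => ?_
    by_cases hx : p x = 0
    · simp [hx]
    refine Tendsto.const_mul _ (Tendsto.log ?_ hx)
    simpa using (tendsto_inv_atTop_zero.const_mul (q x)).add_const (p x)
  refine h.congr' ?_
  filter_upwards [eventually_gt_atTop 0] with t ht
  rw [Finset.sum_mul, ← Finset.sum_sub_distrib]
  refine Finset.sum_congr rfl fun x _ => ?_
  by_cases hx : p x = 0
  · simp [hx]
  have hpos : 0 < p x := lt_of_le_of_ne (hp x) (Ne.symm hx)
  have hpos' : 0 < q x * t⁻¹ + p x := by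
    have := mul_nonneg (hq x) (inv_nonneg.2 ht.le)
    positivity
  have e : q x + t * p x = (q x * t⁻¹ + p x) * t := by
    field_simp
  rw [e, Real.log_mul hpos'.ne' ht.ne']
  ring

/-- Comparison of the sums `∑ m p (log p - log q)` from the comparison of
`∑ m p² / (q + t p)` for all `t ≥ 0`. -/
theorem sum_mul_log_sub_le {m p q : X → ℝ} {m' p' q' : X' → ℝ}
    (hp : ∀ x, 0 ≤ p x) (hq : ∀ x, 0 ≤ q x) (hpq : ∀ x, m x ≠ 0 → p x ≠ 0 → q x ≠ 0)
    (hp' : ∀ x, 0 ≤ p' x) (hq' : ∀ x, 0 ≤ q' x) (hpq' : ∀ x, m' x ≠ 0 → p' x ≠ 0 → q' x ≠ 0)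
    (hsum : ∑ x, m x * p x = ∑ x, m' x * p' x)
    (hle : ∀ t : ℝ, 0 ≤ t → ∑ x, m' x * (p' x ^ 2 / (q' x + t * p' x)) ≤
      ∑ x, m x * (p x ^ 2 / (q x + t * p x))) :
    ∑ x, m' x * p' x * (Real.log (p' x) - Real.log (q' x)) ≤
      ∑ x, m x * p x * (Real.log (p x) - Real.log (q x)) := by
  set H : ℝ → ℝ := fun t => ∑ x, m x * p x * Real.log (q x + t * p x)
    - ∑ x, m' x * p' x * Real.log (q' x + t * p' x) with hH
  have hd (t : ℝ) (ht : 0 ≤ t) := (hasDerivAt_sum_mul_log hp hq hpq ht).sub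
    (hasDerivAt_sum_mul_log hp' hq' hpq' ht)
  have hmono : MonotoneOn H (Set.Ici 0) := by
    refine monotoneOn_of_deriv_nonneg (convex_Ici 0)
      (fun t ht => (hd t ht).continuousAt.continuousWithinAt)
      (fun t ht => (hd t (interior_subset ht)).differentiableAt.differentiableWithinAt)
      fun t ht => ?_
    have h := (hd t (interior_subset ht)).deriv
    exact (sub_nonneg.2 (hle t (interior_subset ht))).trans_eq h.symm
  -- The two divergent `log t` terms have equal coefficients by `hsum`, so they cancel.
  have hlim : Tendsto H atTop (𝓝 (∑ x, m x * p x * Real.log (p x)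
      - ∑ x, m' x * p' x * Real.log (p' x))) := by
    refine ((tendsto_sum_mul_log m p q hp hq).sub
      (tendsto_sum_mul_log m' p' q' hp' hq')).congr fun t => ?_
    rw [hsum]
    simp only [hH]
    ring
  have h0 : H 0 ≤ _ := ge_of_tendsto hlim <| by
    filter_upwards [eventually_ge_atTop 0] with t ht
    exact hmono (Set.mem_Ici.2 le_rfl) ht ht
  simp only [hH, zero_mul, add_zero] at h0
  simp only [mul_sub, Finset.sum_sub_distrib]
  linarith

end LogSums

/-! ### The variational form of the derivative -/

section RelativeEntropy

variable {ι κ : Type*} [Fintype ι] [DecidableEq ι] [Fintype κ] [DecidableEq κ]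

theorem trace_conjTranspose_mul_diagonal_mul (y w : Matrix κ ι ℂ) (q : κ → ℂ) (p : ι → ℂ) :
    (yᴴ * Matrix.diagonal q * w * Matrix.diagonal p).trace =
      ∑ x : κ × ι, star (y x.1 x.2) * w x.1 x.2 * (q x.1 * p x.2) := by
  rw [Fintype.sum_prod_type_right]
  simp only [Matrix.trace, Matrix.diag_apply, Matrix.mul_diagonal]
  refine Finset.sum_congr rfl fun i _ => ?_
  rw [Matrix.mul_apply, Finset.sum_mul]
  refine Finset.sum_congr rfl fun j _ => ?_
  rw [Matrix.mul_diagonal, Matrix.conjTranspose_apply]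
  ring

/-- The concave quadratic form whose supremum over `Y` is `⟨R, (L_S + t R_R)⁻¹ R⟩`, where `L` and `R`
denote left and right multiplication and the inner product is that of Hilbert and Schmidt. -/
def modularForm (R S : Matrix ι ι ℂ) (t : ℝ) (Y : Matrix ι ι ℂ) : ℝ :=
  2 * (Yᴴ * R).trace.re - (Yᴴ * S * Y).trace.re - t * (Y * R * Yᴴ).trace.re

/-- The linear term is preserved by duality. Kadison–Schwarz, used for `Y` with `S` and for `Y†`
with `R`, controls the two subtracted quadratic terms. -/
theorem modularForm_krausMap_le {α : Type*} [Fintype α] {K : α → Matrix κ ι ℂ}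
    (hK : ∑ a, (K a)ᴴ * K a = 1) {R S : Matrix ι ι ℂ} (hR : R.PosSemidef) (hS : S.PosSemidef)
    {t : ℝ} (ht : 0 ≤ t) (Y : Matrix κ κ ℂ) :
    modularForm (krausMap K R) (krausMap K S) t Y ≤ modularForm R S t (krausAdjoint K Y) := by
  have h1 := re_trace_krausAdjoint_le hK hS Y
  have h2 := re_trace_krausAdjoint_le hK hR Yᴴ
  rw [← conjTranspose_krausAdjoint, Matrix.conjTranspose_conjTranspose,
    Matrix.conjTranspose_conjTranspose] at h2
  have h3 := mul_le_mul_of_nonneg_left h2 ht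
  rw [modularForm, modularForm, trace_mul_krausMap, conjTranspose_krausAdjoint]
  rw [conjTranspose_krausAdjoint] at h1 h3
  linarith

/-- Left multiplication by `S` and right multiplication by `R` are simultaneously diagonal in these
coordinates, so the form decouples into scalar quadratics. -/
theorem modularForm_eq_sum {V W : Matrix ι ι ℂ} {p q : ι → ℝ} (hV : Vᴴ * V = 1)
    (hW : Wᴴ * W = 1) (t : ℝ) (y : Matrix ι ι ℂ) :
    modularForm (V * Matrix.diagonal (fun i => (p i : ℂ)) * Vᴴ)
      (W * Matrix.diagonal (fun i => (q i : ℂ)) * Wᴴ) t (W * y * Vᴴ) =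
    ∑ x : ι × ι, (2 * p x.2 * (star (y x.1 x.2) * (Wᴴ * V) x.1 x.2).re
      - (q x.1 + t * p x.2) * Complex.normSq (y x.1 x.2)) := by
  have c1 (M : Matrix ι ι ℂ) : Vᴴ * (V * M) = M := by rw [← Matrix.mul_assoc, hV, Matrix.one_mul]
  have c2 (M : Matrix ι ι ℂ) : Wᴴ * (W * M) = M := by rw [← Matrix.mul_assoc, hW, Matrix.one_mul]
  have e1 : ((W * y * Vᴴ)ᴴ * (V * Matrix.diagonal (fun i => (p i : ℂ)) * Vᴴ)).trace =
      (yᴴ * Matrix.diagonal (fun _ => 1) * (Wᴴ * V) * Matrix.diagonal (fun i => (p i : ℂ))).trace := by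
    rw [← trace_conj_isometry hV (yᴴ * _ * _ * _)]
    simp [Matrix.mul_assoc, Matrix.conjTranspose_mul]
  have e2 : ((W * y * Vᴴ)ᴴ * (W * Matrix.diagonal (fun i => (q i : ℂ)) * Wᴴ) *
      (W * y * Vᴴ)).trace =
      (yᴴ * Matrix.diagonal (fun i => (q i : ℂ)) * y * Matrix.diagonal (fun _ => 1)).trace := by
    rw [← trace_conj_isometry hV (yᴴ * _ * _ * _)]
    simp [Matrix.mul_assoc, Matrix.conjTranspose_mul, c2]
  have e3 : ((W * y * Vᴴ) * (V * Matrix.diagonal (fun i => (p i : ℂ)) * Vᴴ) *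
      (W * y * Vᴴ)ᴴ).trace =
      (yᴴ * Matrix.diagonal (fun _ => 1) * y * Matrix.diagonal (fun i => (p i : ℂ))).trace := by
    have h : (yᴴ * Matrix.diagonal (fun _ => 1) * y * Matrix.diagonal (fun i => (p i : ℂ))).trace =
        (y * Matrix.diagonal (fun i => (p i : ℂ)) * yᴴ).trace := by
      rw [Matrix.trace_mul_comm _ yᴴ, Matrix.diagonal_one, Matrix.mul_one, Matrix.mul_assoc]
    rw [h, ← trace_conj_isometry hW (y * _ * _)]
    simp [Matrix.mul_assoc, Matrix.conjTranspose_mul, c1]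
  rw [modularForm, e1, e2, e3]
  simp only [trace_conjTranspose_mul_diagonal_mul, Complex.re_sum, Finset.mul_sum,
    ← Finset.sum_sub_distrib]
  refine Finset.sum_congr rfl fun x _ => ?_
  simp only [one_mul, mul_one, Complex.normSq_apply, Complex.star_def, Complex.mul_re,
    Complex.mul_im, Complex.conj_re, Complex.conj_im, Complex.ofReal_re, Complex.ofReal_im]
  ring

theorem modularForm_le_sum {V W : Matrix ι ι ℂ} {p q : ι → ℝ} (hV : Vᴴ * V = 1) (hV' : V * Vᴴ = 1)
    (hW : Wᴴ * W = 1) (hW' : W * Wᴴ = 1) (hp : ∀ i, 0 ≤ p i) (hq : ∀ i, 0 ≤ q i)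
    {t : ℝ} (ht : 0 ≤ t) (Y : Matrix ι ι ℂ) (hpq : ∀ x : ι × ι,
      Complex.normSq ((Wᴴ * V) x.1 x.2) ≠ 0 → p x.2 ≠ 0 → q x.1 ≠ 0) :
    modularForm (V * Matrix.diagonal (fun i => (p i : ℂ)) * Vᴴ)
      (W * Matrix.diagonal (fun i => (q i : ℂ)) * Wᴴ) t Y ≤
    ∑ x : ι × ι, Complex.normSq ((Wᴴ * V) x.1 x.2) * (p x.2 ^ 2 / (q x.1 + t * p x.2)) := by
  have hY : Y = W * (Wᴴ * Y * V) * Vᴴ := by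
    simp only [Matrix.mul_assoc, hV', Matrix.mul_one]
    rw [← Matrix.mul_assoc, hW', Matrix.one_mul]
  rw [hY, modularForm_eq_sum hV hW]
  refine Finset.sum_le_sum fun x _ => ?_
  set y := (Wᴴ * Y * V) x.1 x.2
  set w := (Wᴴ * V) x.1 x.2
  have hx := hpq x
  have hp := hp x.2
  have hq := hq x.1
  generalize p x.2 = a at *
  generalize q x.1 = b at *
  have hta : 0 ≤ t * a := mul_nonneg ht hp
  rcases (add_nonneg hq hta).eq_or_lt with h | h
  -- The quotient by zero is `0` here, so the linear term must vanish too; the support condition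
  -- ensures this.
  · have hb : b = 0 := by linarith
    have : a = 0 ∨ w = 0 := by
      by_contra! hc
      exact hx (by simpa using hc.2) hc.1 hb
    rw [← h]
    rcases this with h' | h' <;> simp [h']
  · rw [mul_div_assoc', le_div_iff₀ h]
    -- Completing the square in the entry `y`.
    have e : Complex.normSq w * a ^ 2 - (2 * a * (star y * w).re
        - (b + t * a) * Complex.normSq y) * (b + t * a) =
        (a * w.re - (b + t * a) * y.re) ^ 2 + (a * w.im - (b + t * a) * y.im) ^ 2 := by
      simp only [Complex.normSq_apply, Complex.star_def, Complex.mul_re, Complex.conj_re,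
        Complex.conj_im]
      ring
    nlinarith [sq_nonneg (a * w.re - (b + t * a) * y.re), sq_nonneg (a * w.im - (b + t * a) * y.im)]

theorem exists_modularForm_eq_sum {V W : Matrix ι ι ℂ} {p q : ι → ℝ} (hV : Vᴴ * V = 1)
    (hW : Wᴴ * W = 1) (t : ℝ) :
    ∃ Y, modularForm (V * Matrix.diagonal (fun i => (p i : ℂ)) * Vᴴ)
      (W * Matrix.diagonal (fun i => (q i : ℂ)) * Wᴴ) t Y =
    ∑ x : ι × ι, Complex.normSq ((Wᴴ * V) x.1 x.2) * (p x.2 ^ 2 / (q x.1 + t * p x.2)) := by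
  -- The critical point `y = p w / (q + t p)` of each scalar quadratic; where the denominator is
  -- zero, `y = 0` and both sides vanish.
  refine ⟨W * Matrix.of (fun j i => ((p i / (q j + t * p i) : ℝ) : ℂ) * (Wᴴ * V) j i) * Vᴴ, ?_⟩
  rw [modularForm_eq_sum hV hW]
  refine Finset.sum_congr rfl fun x _ => ?_
  rw [Matrix.of_apply]
  generalize (Wᴴ * V) x.1 x.2 = w
  generalize q x.1 + t * p x.2 = D
  rcases eq_or_ne D 0 with h | h
  · simp [h]
  · simp only [Complex.normSq_apply, Complex.star_def, Complex.mul_re, Complex.conj_re,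
      Complex.conj_im, Complex.mul_im, Complex.ofReal_re, Complex.ofReal_im]
    field_simp
    ring

/-- Unitarity of the overlap matrix lets both traces be written over the same pairs of eigenvectors.
Keeping `r`, `s` arbitrary covers the logarithms and also the normalization of the weights. -/
theorem trace_mul_log_sub_log_eq_sum {V W : Matrix ι ι ℂ} {p r s : ι → ℝ} (hV : Vᴴ * V = 1)
    (hW' : W * Wᴴ = 1) :
    (V * Matrix.diagonal (fun i => (p i : ℂ)) * Vᴴ *
      (V * Matrix.diagonal (fun i => (r i : ℂ)) * Vᴴ
        - W * Matrix.diagonal (fun i => (s i : ℂ)) * Wᴴ)).trace.re =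
    ∑ x : ι × ι, Complex.normSq ((Wᴴ * V) x.1 x.2) * p x.2 * (r x.2 - s x.1) := by
  have c1 (M : Matrix ι ι ℂ) : Vᴴ * (V * M) = M := by rw [← Matrix.mul_assoc, hV, Matrix.one_mul]
  have c2 (M : Matrix ι ι ℂ) : W * (Wᴴ * M) = M := by rw [← Matrix.mul_assoc, hW', Matrix.one_mul]
  have e1 : (V * Matrix.diagonal (fun i => (p i : ℂ)) * Vᴴ *
      (V * Matrix.diagonal (fun i => (r i : ℂ)) * Vᴴ)).trace =
      ((Wᴴ * V)ᴴ * Matrix.diagonal (fun _ => 1) * (Wᴴ * V) *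
        Matrix.diagonal (fun i => (p i : ℂ) * (r i : ℂ))).trace := by
    have c3 (M : Matrix ι ι ℂ) : Matrix.diagonal (fun i => (p i : ℂ)) *
        (Matrix.diagonal (fun i => (r i : ℂ)) * M) =
        Matrix.diagonal (fun i => (p i : ℂ) * (r i : ℂ)) * M := by
      rw [← Matrix.mul_assoc, Matrix.diagonal_mul_diagonal]
    rw [← trace_conj_isometry hV ((Wᴴ * V)ᴴ * _ * _ * _)]
    simp [Matrix.mul_assoc, Matrix.conjTranspose_mul, c1, c2, c3]
  have e2 : (V * Matrix.diagonal (fun i => (p i : ℂ)) * Vᴴ *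
      (W * Matrix.diagonal (fun i => (s i : ℂ)) * Wᴴ)).trace =
      ((Wᴴ * V)ᴴ * Matrix.diagonal (fun i => (s i : ℂ)) * (Wᴴ * V) *
        Matrix.diagonal (fun i => (p i : ℂ))).trace := by
    rw [Matrix.mul_assoc, Matrix.trace_mul_comm]
    simp only [Matrix.mul_assoc, Matrix.conjTranspose_mul, Matrix.conjTranspose_conjTranspose]
  rw [Matrix.mul_sub, Matrix.trace_sub, e1, e2]
  simp only [trace_conjTranspose_mul_diagonal_mul, Complex.sub_re, Complex.re_sum,
    ← Finset.sum_sub_distrib]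
  refine Finset.sum_congr rfl fun x _ => ?_
  simp only [one_mul, Complex.normSq_apply, Complex.star_def, Complex.mul_re,
    Complex.mul_im, Complex.conj_re, Complex.conj_im, Complex.ofReal_re, Complex.ofReal_im]
  ring

end RelativeEntropy

/-! ### Data processing for the relative entropy -/

section DataProcessing

variable {ι κ : Type*} [Fintype ι] [DecidableEq ι] [Fintype κ] [DecidableEq κ]

/-- An eigenvector of the second matrix with eigenvalue `0` lies in the kernel of the first, hence
is orthogonal to every eigenvector of the first with `p ≠ 0`. -/
theorem support_overlap {V W : Matrix ι ι ℂ} {p q : ι → ℝ} (hV : Vᴴ * V = 1)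
    (hW : Wᴴ * W = 1) (h : ∀ v, (W * Matrix.diagonal (fun i => (q i : ℂ)) * Wᴴ) *ᵥ v = 0 →
      (V * Matrix.diagonal (fun i => (p i : ℂ)) * Vᴴ) *ᵥ v = 0)
    (x : ι × ι) (hx : Complex.normSq ((Wᴴ * V) x.1 x.2) ≠ 0) (hp : p x.2 ≠ 0) : q x.1 ≠ 0 := by
  intro hq
  have h1 : (W * Matrix.diagonal (fun i => (q i : ℂ)) * Wᴴ) *ᵥ (W *ᵥ Pi.single x.1 1) = 0 := by
    rw [Matrix.mulVec_mulVec, Matrix.mul_assoc, hW, Matrix.mul_one, ← Matrix.mulVec_mulVec,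
      Matrix.diagonal_mulVec_single, hq]
    simp
  have h2 : Matrix.diagonal (fun i => (p i : ℂ)) *ᵥ ((Vᴴ * W) *ᵥ Pi.single x.1 1) = 0 := by
    have h3 := congrArg (Vᴴ *ᵥ ·) (h _ h1)
    simp only [Matrix.mulVec_mulVec, Matrix.mulVec_zero, ← Matrix.mul_assoc, hV,
      Matrix.one_mul] at h3
    rw [Matrix.mulVec_mulVec, ← Matrix.mul_assoc]
    exact h3
  have h4 := congrFun h2 x.2
  rw [Matrix.mulVec_diagonal, Matrix.mulVec_single_one, Pi.zero_apply, mul_eq_zero] at h4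
  have h5 : (Vᴴ * W) = (Wᴴ * V)ᴴ := by simp
  rcases h4 with h4 | h4
  · exact hp (by exact_mod_cast h4)
  · rw [Matrix.col_apply, h5, Matrix.conjTranspose_apply, star_eq_zero] at h4
    exact hx (by simp [h4])

theorem sum_overlap_mul {V W : Matrix ι ι ℂ} {p : ι → ℝ} (hV : Vᴴ * V = 1) (hW' : W * Wᴴ = 1)
    (h : (V * Matrix.diagonal (fun i => (p i : ℂ)) * Vᴴ).trace = 1) :
    ∑ x : ι × ι, Complex.normSq ((Wᴴ * V) x.1 x.2) * p x.2 = 1 := by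
  have h1 := trace_mul_log_sub_log_eq_sum (p := p) (r := fun _ => 1) (s := fun _ => 0) hV hW'
  have h2 : V * Matrix.diagonal (fun i => (p i : ℂ)) * Vᴴ * (V * Vᴴ) =
      V * Matrix.diagonal (fun i => (p i : ℂ)) * Vᴴ := by
    simp only [Matrix.mul_assoc]
    rw [← Matrix.mul_assoc Vᴴ V, hV, Matrix.one_mul]
  simpa [h2, h] using h1.symm

/-- The data processing inequality for the quantum relative entropy. -/
theorem relEntropy_le_of_krausMap {α : Type*} [Fintype α] {K : α → Matrix κ ι ℂ}
    (hK : ∑ a, (K a)ᴴ * K a = 1) {ρ σ : QState ι} {ρ' σ' : QState κ}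
    (hρ : ρ'.mat = krausMap K ρ.mat) (hσ : σ'.mat = krausMap K σ.mat) :
    relEntropy ρ' σ' ≤ relEntropy ρ σ := by
  by_cases h : ∀ v : ι → ℂ, σ.mat *ᵥ v = 0 → ρ.mat *ᵥ v = 0
  swap
  · rw [relEntropy, relEntropy, if_neg h]
    exact le_top
  have h' : ∀ v : κ → ℂ, σ'.mat *ᵥ v = 0 → ρ'.mat *ᵥ v = 0 := by
    rw [hρ, hσ]
    exact ker_krausMap_le K σ.posSemidef h
  rw [relEntropy, relEntropy, if_pos h, if_pos h', EReal.coe_le_coe_iff]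
  obtain ⟨V, p, hV, hV1, hVρ, hp, hVf⟩ := exists_diagonalization ρ.posSemidef.isHermitian
  obtain ⟨W, q, hW, hW1, hWσ, hq, hWf⟩ := exists_diagonalization σ.posSemidef.isHermitian
  obtain ⟨V', p', hV', hV1', hVρ', hp', hVf'⟩ := exists_diagonalization ρ'.posSemidef.isHermitian
  obtain ⟨W', q', hW', hW1', hWσ', hq', hWf'⟩ := exists_diagonalization σ'.posSemidef.isHermitian
  replace hp := hp ρ.posSemidef
  replace hq := hq σ.posSemidef
  replace hp' := hp' ρ'.posSemidef
  replace hq' := hq' σ'.posSemidef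
  have hform (t : ℝ) (ht : 0 ≤ t) (Y : Matrix κ κ ℂ) :=
    modularForm_krausMap_le hK ρ.posSemidef σ.posSemidef ht Y
  rw [← hρ, ← hσ] at hform
  have ht := ρ.trace_eq_one
  have ht' := ρ'.trace_eq_one
  rw [hVf, hWf, hVf', hWf']
  rw [hVρ, hWσ] at h hform
  rw [hVρ', hWσ'] at h' hform
  rw [hVρ] at ht ⊢
  rw [hVρ'] at ht' ⊢
  rw [trace_mul_log_sub_log_eq_sum hV hW1, trace_mul_log_sub_log_eq_sum hV' hW1']
  have hs := support_overlap hV hW h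
  have hs' := support_overlap hV' hW' h'
  refine sum_mul_log_sub_le (X := ι × ι) (X' := κ × κ) (p := fun x => p x.2) (q := fun x => q x.1)
    (p' := fun x => p' x.2) (q' := fun x => q' x.1) (fun x => hp x.2) (fun x => hq x.1) hs
    (fun x => hp' x.2) (fun x => hq' x.1) hs' ?_ fun t ht => ?_
  · rw [sum_overlap_mul hV hW1 ht, sum_overlap_mul hV' hW1' ht']
  -- The optimal `Y` for the output pair, pulled back by the adjoint channel, is a trial point for
  -- the input pair.
  · obtain ⟨Y, hY⟩ := exists_modularForm_eq_sum (p := p') (q := q') hV' hW' t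
    rw [← hY]
    exact (hform t ht Y).trans (modularForm_le_sum hV hV1 hW hW1 hp hq ht _ hs)

end DataProcessing

/-! ### Convolution as a channel, and its locality -/

section Convolution

variable {d n : ℕ}

theorem keyMap_apply (G : GL (Fin 2) (ZMod d)) (p : Label d n × Label d n) (k : Fin n) :
    ![(keyMap G p).1 k, (keyMap G p).2 k] =
      ((G⁻¹ : GL (Fin 2) (ZMod d)) : Matrix (Fin 2) (Fin 2) (ZMod d))ᵀ *ᵥ ![p.1 k, p.2 k] := by
  funext a
  fin_cases a <;> rfl

theorem keyMap_inv_keyMap (G : GL (Fin 2) (ZMod d)) (p : Label d n × Label d n) :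
    keyMap G⁻¹ (keyMap G p) = p := by
  have h (k : Fin n) : ![(keyMap G⁻¹ (keyMap G p)).1 k, (keyMap G⁻¹ (keyMap G p)).2 k] =
      ![p.1 k, p.2 k] := by
    rw [keyMap_apply, keyMap_apply, Matrix.mulVec_mulVec, ← Matrix.transpose_mul, ← Units.val_mul,
      mul_inv_cancel]
    simp
  exact Prod.ext (funext fun k => by simpa using congrFun (h k) 0)
    (funext fun k => by simpa using congrFun (h k) 1)

theorem keyMap_eq_iff (G : GL (Fin 2) (ZMod d)) (p q : Label d n × Label d n) :
    keyMap G q = p ↔ q = keyMap G⁻¹ p := by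
  constructor
  · rintro rfl
    exact (keyMap_inv_keyMap G q).symm
  · rintro rfl
    simpa using keyMap_inv_keyMap G⁻¹ p

variable [NeZero d]

/-- Tensoring with a state, conjugating by an isometry and discarding a subsystem is a channel. -/
theorem exists_kraus_partialTraceRight {ι κ ι' κ' : Type*} [Fintype ι] [Fintype κ] [Fintype ι']
    [Fintype κ'] [DecidableEq ι] [DecidableEq κ] {U : Matrix (ι' × κ') (ι × κ) ℂ}
    (hU : Uᴴ * U = 1) (τ : QState κ) :
    ∃ K : κ' × κ → Matrix ι' ι ℂ, ∑ a, (K a)ᴴ * K a = 1 ∧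
      ∀ X, partialTraceRight (U * (X ⊗ₖ τ.mat) * Uᴴ) = krausMap K X := by
  obtain ⟨B, hB⟩ := exists_eq_mul_conjTranspose τ.posSemidef
  -- `T l` tensors a vector with the `l`-th column of `B`; since `τ = B B†`, these are Kraus
  -- operators of `X ↦ X ⊗ τ`.
  let T : κ → Matrix (ι × κ) ι ℂ := fun l =>
    Matrix.of fun x i => if x.1 = i then B x.2 l else 0
  have hT : ∑ l, (T l)ᴴ * T l = 1 := by
    have h1 : ∑ l, ∑ j, star (B j l) * B j l = 1 := by
      have h2 := τ.trace_eq_one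
      rw [hB, Matrix.trace_mul_comm] at h2
      simpa [Matrix.trace, Matrix.mul_apply] using h2
    ext a b
    simp only [Matrix.sum_apply, Matrix.mul_apply, Matrix.conjTranspose_apply, T, Matrix.of_apply,
      Fintype.sum_prod_type, Matrix.one_apply]
    rw [← h1]
    by_cases hab : a = b
    · subst hab
      simp
    · have hne : ∀ x : ι, ¬(x = a ∧ x = b) := fun x hx => hab (hx.1.symm.trans hx.2)
      rw [if_neg hab]
      refine Finset.sum_eq_zero fun l _ => Finset.sum_eq_zero fun x _ =>
        Finset.sum_eq_zero fun j _ => ?_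
      by_cases hx : x = a
      · have : x ≠ b := fun h => hne x ⟨hx, h⟩
        simp [this]
      · simp [hx]
  have hX (X : Matrix ι ι ℂ) : X ⊗ₖ τ.mat = ∑ l, T l * X * (T l)ᴴ := by
    ext ⟨a, j⟩ ⟨b, k⟩
    simp only [Matrix.sum_apply, Matrix.kroneckerMap_apply, hB, Matrix.mul_apply,
      Matrix.conjTranspose_apply, T, Matrix.of_apply, Finset.mul_sum, ite_mul, zero_mul,
      Finset.sum_ite_eq, Finset.mem_univ, if_true, apply_ite star, star_zero, mul_ite, mul_zero]
    refine Finset.sum_congr rfl fun l _ => ?_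
    ring
  -- The partial trace contributes the Kraus operators `1 ⊗ ⟨k|`, which select the rows of `U * T l`
  -- with second label `k`.
  refine ⟨fun a => (U * T a.2).submatrix (fun i => (i, a.1)) id, ?_, fun X => ?_⟩
  · have h (l : κ) : ∑ k, ((U * T l).submatrix (fun i => (i, k)) id)ᴴ *
        (U * T l).submatrix (fun i => (i, k)) id = (T l)ᴴ * T l := by
      have h2 : (U * T l)ᴴ * (U * T l) = (T l)ᴴ * T l := by
        rw [Matrix.conjTranspose_mul, Matrix.mul_assoc, ← Matrix.mul_assoc Uᴴ, hU, Matrix.one_mul]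
      rw [← h2]
      ext a b
      simp only [Matrix.sum_apply, Matrix.mul_apply (M := (U * T l)ᴴ),
        Matrix.mul_apply (M := ((U * T l).submatrix _ id)ᴴ), Matrix.conjTranspose_apply,
        Matrix.submatrix_apply, id, Fintype.sum_prod_type_right]
    rw [Fintype.sum_prod_type_right]
    simp only [h, hT]
  · rw [hX, krausMap_apply, Matrix.mul_sum, Matrix.sum_mul, Fintype.sum_prod_type_right]
    have h (l : κ) : U * (T l * X * (T l)ᴴ) * Uᴴ = (U * T l) * X * (U * T l)ᴴ := by
      simp only [Matrix.conjTranspose_mul, Matrix.mul_assoc]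
    simp only [h]
    ext a b
    simp only [partialTraceRight, Matrix.of_apply, Matrix.sum_apply]
    rw [Finset.sum_comm]
    rfl

theorem exists_kraus_conv (G : GL (Fin 2) (ZMod d)) (τ : QState (Label d n)) :
    ∃ K : Label d n × Label d n → Matrix (Label d n) (Label d n) ℂ, ∑ a, (K a)ᴴ * K a = 1 ∧
      ∀ ρ : QState (Label d n), (conv G ρ τ).mat = krausMap K ρ.mat := by
  obtain ⟨K, hK, h⟩ := exists_kraus_partialTraceRight (keyUnitary_conjTranspose_mul (n := n) G) τ
  exact ⟨K, hK, fun ρ => h ρ.mat⟩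

theorem conv_mat_apply (G : GL (Fin 2) (ZMod d)) (ρ τ : QState (Label d n)) (a b : Label d n) :
    (conv G ρ τ).mat a b = ∑ k, ρ.mat (keyMap G⁻¹ (a, k)).1 (keyMap G⁻¹ (b, k)).1 *
      τ.mat (keyMap G⁻¹ (a, k)).2 (keyMap G⁻¹ (b, k)).2 := by
  simp [conv, partialTraceRight, Matrix.mul_apply, keyUnitary_apply, keyMap_eq_iff,
    Matrix.conjTranspose_apply, apply_ite]

/-- Tracing out qudit `i` of the output sums over both of its labels. Since `Gᵀ` permutes pairs of
labels, this is an independent sum over the two input labels, which traces qudit `i` out of both `ρ`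
and `τ`. -/
theorem traceQudit_conv_apply (G : GL (Fin 2) (ZMod d)) (ρ τ : QState (Label d n)) (i : Fin n)
    (a b : {j : Fin n // j ≠ i} → ZMod d) :
    traceQudit i (conv G ρ τ).mat a b = ∑ k : {j : Fin n // j ≠ i} → ZMod d,
      traceQudit i ρ.mat
        (fun j => ((G : Matrix (Fin 2) (Fin 2) (ZMod d))ᵀ *ᵥ ![a j, k j]) 0)
        (fun j => ((G : Matrix (Fin 2) (Fin 2) (ZMod d))ᵀ *ᵥ ![b j, k j]) 0) *
      traceQudit i τ.mat
        (fun j => ((G : Matrix (Fin 2) (Fin 2) (ZMod d))ᵀ *ᵥ ![a j, k j]) 1)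
        (fun j => ((G : Matrix (Fin 2) (Fin 2) (ZMod d))ᵀ *ᵥ ![b j, k j]) 1) := by
  set m := (G : Matrix (Fin 2) (Fin 2) (ZMod d))ᵀ with hm
  have hsplit (x y : ZMod d) (a k : {j : Fin n // j ≠ i} → ZMod d) :
      keyMap G⁻¹ ((Equiv.funSplitAt i (ZMod d)).symm (x, a),
          (Equiv.funSplitAt i (ZMod d)).symm (y, k)) =
        ((Equiv.funSplitAt i (ZMod d)).symm ((m *ᵥ ![x, y]) 0, fun j => (m *ᵥ ![a j, k j]) 0),
          (Equiv.funSplitAt i (ZMod d)).symm ((m *ᵥ ![x, y]) 1, fun j => (m *ᵥ ![a j, k j]) 1)) := by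
    refine Prod.ext (funext fun j => ?_) (funext fun j => ?_) <;>
    · by_cases hj : j = i
      · subst hj
        simp [keyMap, Equiv.funSplitAt, hm]
      · simp [keyMap, Equiv.funSplitAt, hm, hj]
  have hbij : Function.Bijective fun z : ZMod d × ZMod d =>
      ((m *ᵥ ![z.1, z.2]) 0, (m *ᵥ ![z.1, z.2]) 1) := by
    rw [← Finite.injective_iff_bijective]
    intro z w h
    have hinj : Function.Injective m.mulVec := by
      apply Matrix.mulVec_injective_of_isUnit
      rw [hm, Matrix.isUnit_transpose]
      exact G.isUnit
    have h1 : (![z.1, z.2] : Fin 2 → ZMod d) = ![w.1, w.2] := by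
      apply hinj
      funext c
      fin_cases c
      · exact congrArg Prod.fst h
      · exact congrArg Prod.snd h
    exact Prod.ext (by simpa using congrFun h1 0) (by simpa using congrFun h1 1)
  simp only [traceQudit, Matrix.of_apply, conv_mat_apply]
  simp only [← (Equiv.funSplitAt i (ZMod d)).symm.sum_comp, Fintype.sum_prod_type, hsplit]
  rw [Finset.sum_congr rfl fun x _ => Finset.sum_comm, Finset.sum_comm]
  refine Finset.sum_congr rfl fun k _ => ?_
  rw [Finset.sum_mul_sum, ← Fintype.sum_prod_type', ← Fintype.sum_prod_type']
  exact hbij.sum_comp fun z : ZMod d × ZMod d =>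
    ρ.mat ((Equiv.funSplitAt i (ZMod d)).symm (z.1, fun j => (m *ᵥ ![a j, k j]) 0))
      ((Equiv.funSplitAt i (ZMod d)).symm (z.1, fun j => (m *ᵥ ![b j, k j]) 0)) *
    τ.mat ((Equiv.funSplitAt i (ZMod d)).symm (z.2, fun j => (m *ᵥ ![a j, k j]) 1))
      ((Equiv.funSplitAt i (ZMod d)).symm (z.2, fun j => (m *ᵥ ![b j, k j]) 1))

theorem wassersteinDist_conv_le (G : GL (Fin 2) (ZMod d)) (ρ σ τ : QState (Label d n)) :
    wassersteinDist (conv G ρ τ) (conv G σ τ) ≤ wassersteinDist ρ σ := by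
  obtain ⟨K, -, h⟩ := exists_kraus_conv G τ
  -- Every decomposition for `ρ - σ` yields one of equal cost for the convolutions, so attainment of
  -- the infimum is not needed.
  refine le_iInf fun c => le_iInf fun μ => le_iInf fun ν => le_iInf fun htr => le_iInf fun hdec => ?_
  refine iInf_le_of_le c <| iInf_le_of_le (fun i => conv G (μ i) τ) <|
    iInf_le_of_le (fun i => conv G (ν i) τ) <| iInf_le_of_le (fun i => ?_) <| iInf_le _ ?_
  · ext a b
    rw [traceQudit_conv_apply, traceQudit_conv_apply, htr i]
  · simp only [h, ← map_sub, hdec, map_sum, map_smul]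

end Convolution

end

end QuantumConvolution

theorem mainTheorem10 (d n : ℕ) [Fact d.Prime] (G : GL (Fin 2) (ZMod d))
    (hG : QuantumConvolution.IsPositive G)
    (ρ σ τ : QuantumConvolution.QState (QuantumConvolution.Label d n)) :
    QuantumConvolution.l1Dist (QuantumConvolution.conv G ρ τ) (QuantumConvolution.conv G σ τ)
        ≤ QuantumConvolution.l1Dist ρ σ ∧
    QuantumConvolution.relEntropy (QuantumConvolution.conv G ρ τ) (QuantumConvolution.conv G σ τ)
        ≤ QuantumConvolution.relEntropy ρ σ ∧
    QuantumConvolution.wassersteinDist (QuantumConvolution.conv G ρ τ)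
        (QuantumConvolution.conv G σ τ)
        ≤ QuantumConvolution.wassersteinDist ρ σ := by
  obtain ⟨K, hK, h⟩ := QuantumConvolution.exists_kraus_conv G τ
  exact ⟨QuantumConvolution.l1Dist_le_of_krausMap hK (h ρ) (h σ),
    QuantumConvolution.relEntropy_le_of_krausMap hK (h ρ) (h σ),
    QuantumConvolution.wassersteinDist_conv_le G ρ σ τ⟩
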